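/- **Setting.** Let $\mathcal V=(Q,\le,\otimes,1)$ be a completely distributive commutative unital quantale whose unit $1$ is the greatest element and $\bot\neq 1$; write $\hom$ for its internal hom ($z\le\hom(x,y)\iff z\otimes x\le y$). Let $\mathbb U=(U,e,m)$ be the ultrafilter monad on sets, and let $\xi:UQ\to Q$, $\xi(\sigma)=\bigwedge_{A\in\sigma}\bigvee A$, be the convergence of the Lawson topology of $Q$. Assume that $\otimes$ is continuous, i.e. $\xi(U(\otimes)(\omega))=\xi(U\pi_1(\omega))\otimes\xi(U\pi_2(\omega))$ for $\omega\in U(Q\times Q)$, and that for all maps $f:X\to Y$, $\varphi:X\to Q$, $\psi:Y\to Q$ with $\psi(y)\le\bigvee_{f(x)=y}\varphi(x)$ for all $y$, one has $\xi(U\psi(\sigma))\le\bigvee_{Uf(\nu)=\sigma}\xi(U\varphi(\nu))$ for all $\sigma\in UY$. For $r:X\times Y\to Q$ put $Ur(\sigma,\nu)=\bigwedge_{A\in\sigma,B\in\nu}\bigvee_{x\in A,y\in B}r(x,y)$. A $(\mathbb U,\mathcal V)$-relation $\alpha:X\rightharpoonup Y$ is a map $UX\times Y\to Q$. Put $\hat\alpha(\sigma,\nu)=\bigvee_{m_X(\Upsilon)=\sigma}U\alpha(\Upsilon,\nu)$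 for $\sigma\in UX$, $\nu\in UY$. The composite of $\alpha:X\rightharpoonup Y$ and $\beta:Y\rightharpoonup Z$ is $(\beta\circ\alpha)(\sigma,z)=\bigvee_{\nu\in UY}\hat\alpha(\sigma,\nu)\otimes\beta(\nu,z)$, and for $\gamma:X\rightharpoonup Z$ one sets $(\gamma\triangleleft\alpha)(\nu,z)=\bigwedge_{\sigma\in UX}\hom(\hat\alpha(\sigma,\nu),\gamma(\sigma,z))$, so that $\beta\circ\alpha\le\gamma\iff\beta\le\gamma\triangleleft\alpha$. A $(\mathbb U,\mathcal V)$-category is a set $X$ with a relation $X:X\rightharpoonup X$ such that $1\le X(e(x),x)$ and $UX(\Upsilon,\nu)\otimes X(\nu,x)\le X(m_X(\Upsilon),x)$. A functor $f:X\to Y$ is a map with $X(\sigma,x)\le Y(Uf(\sigma),f(x))$; functors are ordered by $f\le g\iff 1\le Y(e(f(x)),g(x))$ for all $x$. A distributor $\varphi:X\rightharpoonup Y$ is a relation with $\varphi\circ X=\varphi=Y\circ\varphi$. A functor $f:X\to Y$ gives distributors $f_*:X\rightharpoonup Y$, $f_*(\sigma,y)=Y(Uf(\sigma),y)$, and $f^*:Y\rightharpoonup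 X$, $f^*(\nu,x)=Y(\nu,f(x))$; in particular each point $x:1\to X$ gives $x_*:1\rightharpoonup X$ and $x^*:X\rightharpoonup 1$, where $1$ is the one-point category with constant structure $1$. Let $J$ be a subcategory of the category of all $(\mathbb U,\mathcal V)$-categories and distributors, containing all objects and every $f^*$, and such that a distributor $\varphi:X\rightharpoonup Y$ is in $J$ whenever $y^*\circ\varphi\in J$ for all $y\in Y$. Let $JX$ be the set of distributors $X\rightharpoonup 1$ in $J$, with the structure $$JX(p,\psi)=\bigwedge_{q}\hom\bigl(\xi(U\mathrm{ev}(q)),\psi(m_X(U\pi_1(q)))\bigr),$$ where $q$ runs over the ultrafilters on $UX\times\{\text{maps }UX\to Q\}$ whose second projection is the image of $p\in U(JX)$. Let $\mathbf y:X\to JX$, $\mathbf y(x)=x^*$, be the Yoneda functor. $X$ is $J$-cocomplete if $\mathbf y$ has a left adjoint functor $\mathrm{Sup}:JX\to X$; such an $X$ is $J$-continuous if moreover $\mathrm{Sup}$ has a left adjoint functor. For a $J$-cocomplete $X$, a distributor $v:X\rightharpoonup X$ is *$J$-cocontinuous* if $\mathrm{Sup}^*\circ v=\mathbf y_*\circ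 v$; *approximating* if $v\in J$ and $X\triangleleft v=X$; *approximating at* $x\in X$ if $v\in J$ and $X\triangleleft(x^*\circ v)=x_*$. The *way-below distributor* of $X$ is, if it exists, the distributor $\Downarrow:X\rightharpoonup X$ such that, for all distributors $\gamma:X\rightharpoonup X$, $\mathrm{Sup}^*\circ\gamma\le\mathbf y_*\iff\gamma\le{\Downarrow}$. **Theorem.** For a $J$-cocomplete $(\mathbb U,\mathcal V)$-category $X$, the following are equivalent: 1. $X$ is $J$-continuous; 2. the way-below distributor $\Downarrow:X\rightharpoonup X$ exists and is approximating; 3. there is a $J$-cocontinuous approximating distributor $v:X\rightharpoonup X$; 4. there is a $J$-cocontinuous distributor $v:X\rightharpoonup X$ which is approximating at $x$, for each $x\in X$. -/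

import Mathlib

universe u

namespace UVCont

/-! ## Ultrafilters -/

/-- The multiplication `m_X : UUX → UX` of the ultrafilter monad (the filtered sum). -/
def join {X : Type u} (Υ : Ultrafilter (Ultrafilter X)) : Ultrafilter X :=
  Υ.bind id

theorem mem_join {X : Type u} {Υ : Ultrafilter (Ultrafilter X)} {A : Set X} :
    A ∈ join Υ ↔ {σ : Ultrafilter X | A ∈ σ} ∈ Υ :=
  Iff.rfl

/-- The convergence `ξ : UQ → Q`, `ξ σ = ⋀_{A ∈ σ} ⋁ A`, of the Lawson topology. -/
def lawsonLim {Q : Type u} [CompleteLattice Q] (σ : Ultrafilter Q) : Q :=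
  ⨅ A : Set Q, ⨅ _ : A ∈ σ, sSup A

/-! ## The quantale -/

/-- The standing assumptions on the completely distributive commutative unital quantale `Q`: the
unit is the greatest element and differs from `⊥`, the tensor is continuous for the Lawson
topology, and `ξ` satisfies the technical condition on suprema along fibres. -/
class IsLawsonQuantale (Q : Type u) [CompletelyDistribLattice Q] [CommMonoid Q]
    [IsQuantale Q] : Prop where
  one_eq_top : (1 : Q) = ⊤
  bot_ne_one : (⊥ : Q) ≠ 1
  lawsonLim_mul : ∀ ω : Ultrafilter (Q × Q),
    lawsonLim (ω.map fun p => p.1 * p.2) =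
      lawsonLim (ω.map Prod.fst) * lawsonLim (ω.map Prod.snd)
  lawsonLim_fibre : ∀ {X Y : Type u} (f : X → Y) (φ : X → Q) (ψ : Y → Q),
    (∀ y, ψ y ≤ ⨆ x : X, ⨆ _ : f x = y, φ x) →
      ∀ σ : Ultrafilter Y, lawsonLim (σ.map ψ) ≤
        ⨆ ν : Ultrafilter X, ⨆ _ : ν.map f = σ, lawsonLim (ν.map φ)

variable {Q : Type u} [CompletelyDistribLattice Q] [CommMonoid Q] [IsQuantale Q]

/-- The internal hom of the quantale: `z ≤ hom x y ↔ z * x ≤ y`. -/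
def hom (x y : Q) : Q := Quantale.leftMulResiduation x y

/-! ## Relations -/

/-- A `(𝕌,Q)`-relation from `X` to `Y` is a `Q`-relation from `UX` to `Y`. -/
abbrev URel (Q : Type u) (X Y : Type u) : Type u := Ultrafilter X → Y → Q

/-- The extension `Ur` of a `Q`-relation `r` to ultrafilters. -/
def extend {X Y : Type u} (r : X → Y → Q) (σ : Ultrafilter X) (ν : Ultrafilter Y) : Q :=
  ⨅ A : Set X, ⨅ _ : A ∈ σ, ⨅ B : Set Y, ⨅ _ : B ∈ ν, ⨆ x ∈ A, ⨆ y ∈ B, r x y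

/-- The `Q`-relation `Uα · m_X^op` from `UX` to `UY`. -/
def lift {X Y : Type u} (α : URel Q X Y) (σ : Ultrafilter X) (ν : Ultrafilter Y) : Q :=
  ⨆ Υ : Ultrafilter (Ultrafilter X), ⨆ _ : join Υ = σ, extend α Υ ν

/-- The Kleisli convolution `β ∘ α = β · Uα · m_X^op`. -/
def kleisli {X Y Z : Type u} (β : URel Q Y Z) (α : URel Q X Y) : URel Q X Z :=
  fun σ z => ⨆ ν : Ultrafilter Y, lift α σ ν * β ν z

/-- The extension `γ ◁ α` of `γ` along `α`: the value at `γ` of the right adjoint of `(-) ∘ α`. -/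
def extension {X Y Z : Type u} (γ : URel Q X Z) (α : URel Q X Y) : URel Q Y Z :=
  fun ν z => ⨅ σ : Ultrafilter X, hom (lift α σ ν) (γ σ z)

theorem kleisli_le_iff {X Y Z : Type u} (β : URel Q Y Z) (α : URel Q X Y) (γ : URel Q X Z) :
    kleisli β α ≤ γ ↔ β ≤ extension γ α := by
  simp only [Pi.le_def, kleisli, extension, hom, iSup_le_iff, le_iInf_iff,
    Quantale.leftMulResiduation_le_iff_mul_le]
  constructor
  · intro h ν z σ
    rw [mul_comm]
    exact h σ z ν
  · intro h σ z ν
    rw [mul_comm]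
    exact h ν z σ

/-- For `f : X → Y` into a set with structure `b`, the relation `f_*(σ,y) = b(Uf(σ),y)`. -/
def lowerStar {X Y : Type u} (b : URel Q Y Y) (f : X → Y) : URel Q X Y :=
  fun σ y => b (σ.map f) y

/-- For `f : X → Y` into a set with structure `b`, the relation `f^*(ν,x) = b(ν,f x)`. -/
def upperStar {X Y : Type u} (b : URel Q Y Y) (f : X → Y) : URel Q Y X :=
  fun ν x => b ν (f x)

/-! ## Categories, functors, distributors -/

/-- `(𝕌,Q)`-functors between sets with structures `a` and `b`. -/
def IsFunctor {X Y : Type u} (a : URel Q X X) (b : URel Q Y Y) (f : X → Y) : Prop :=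
  ∀ σ x, a σ x ≤ b (σ.map f) (f x)

/-- `f ⊣ g` in the ordered category of `(𝕌,Q)`-categories, where `h ≤ k` for functors
`h, k : Z → W` means `1 ≤ W(e(h z), k z)` for all `z`. -/
structure IsAdjunction {X Y : Type u} (a : URel Q X X) (b : URel Q Y Y)
    (f : X → Y) (g : Y → X) : Prop where
  left : IsFunctor a b f
  right : IsFunctor b a g
  unit : ∀ x, 1 ≤ a (pure x) (g (f x))
  counit : ∀ y, 1 ≤ b (pure (f (g y))) y

/-- A `(𝕌,Q)`-category. -/
structure UVCat (Q : Type u) [CompletelyDistribLattice Q] [CommMonoid Q] [IsQuantale Q] where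
  carrier : Type u
  str : URel Q carrier carrier
  refl : ∀ x, 1 ≤ str (pure x) x
  trans : ∀ Υ ν x, extend str Υ ν * str ν x ≤ str (join Υ) x

/-- The one-point `(𝕌,Q)`-category, all of whose values are the unit. -/
def UVCat.one (Q : Type u) [CompletelyDistribLattice Q] [CommMonoid Q] [IsQuantale Q]
    [IsLawsonQuantale Q] : UVCat Q where
  carrier := PUnit.{u + 1}
  str := fun _ _ => 1
  refl := fun _ => le_rfl
  trans := fun _ _ _ => by
    rw [IsLawsonQuantale.one_eq_top (Q := Q)]
    exact le_top

/-- `φ : X ⇸ Y` is a `(𝕌,Q)`-distributor. -/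
def IsDistributor (X Y : UVCat Q) (φ : URel Q X.carrier Y.carrier) : Prop :=
  kleisli φ X.str = φ ∧ kleisli Y.str φ = φ

section Point

variable [IsLawsonQuantale Q]

/-- The map `1 → X` picking the point `x`. -/
def UVCat.point (X : UVCat Q) (x : X.carrier) : (UVCat.one Q).carrier → X.carrier :=
  fun _ => x

theorem UVCat.isFunctor_point (X : UVCat Q) (x : X.carrier) :
    IsFunctor (UVCat.one Q).str X.str (X.point x) := by
  intro σ p
  have hσ : σ.map (X.point x) = pure x := by
    refine Ultrafilter.coe_injective ?_
    exact Filter.map_const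
  rw [hσ]
  exact X.refl x

/-- `x_* : 1 ⇸ X`. -/
def UVCat.pointLower (X : UVCat Q) (x : X.carrier) :
    URel Q (UVCat.one Q).carrier X.carrier :=
  lowerStar X.str (X.point x)

/-- `x^* : X ⇸ 1`. -/
def UVCat.pointUpper (X : UVCat Q) (x : X.carrier) :
    URel Q X.carrier (UVCat.one Q).carrier :=
  upperStar X.str (X.point x)

end Point

/-! ## Classes of weights and presheaves -/

variable [IsLawsonQuantale Q]

/-- A class `J` of distributors forming a subcategory of the category of all distributors,
containing all `f^*`, and such that `φ ∈ J` as soon as `y^* ∘ φ ∈ J` for all points `y`.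
(It contains the identities since `X = (id_X)^*`.) -/
structure WeightClass (Q : Type u) [CompletelyDistribLattice Q] [CommMonoid Q] [IsQuantale Q]
    [IsLawsonQuantale Q] where
  Mem : ∀ X Y : UVCat Q, URel Q X.carrier Y.carrier → Prop
  isDistributor : ∀ {X Y : UVCat Q} {φ}, Mem X Y φ → IsDistributor X Y φ
  comp : ∀ {X Y Z : UVCat Q} {φ ψ}, Mem X Y φ → Mem Y Z ψ → Mem X Z (kleisli ψ φ)
  upperStar_mem : ∀ {X Y : UVCat Q} {f : X.carrier → Y.carrier},
    IsFunctor X.str Y.str f → Mem Y X (upperStar Y.str f)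
  of_points : ∀ {X Y : UVCat Q} {φ}, IsDistributor X Y φ →
    (∀ y, Mem X (UVCat.one Q) (kleisli (Y.pointUpper y) φ)) → Mem X Y φ

/-- The structure of the exponential `Q^|X|`, where `|X| = (UX, m_X)` and `Q` carries the structure
`(σ,v) ↦ hom (ξ σ) v`: the value at `(p,ψ)` is the meet, over all ultrafilters `q` on
`UX × Q^|X|` with `Uπ₂(q) = p`, of `hom (ξ (U ev (q))) (ψ (m_X (Uπ₁(q))))`. -/
def expStr (X : UVCat Q) (p : Ultrafilter (URel Q X.carrier (UVCat.one Q).carrier))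
    (ψ : URel Q X.carrier (UVCat.one Q).carrier) : Q :=
  ⨅ q : Ultrafilter (Ultrafilter X.carrier × URel Q X.carrier (UVCat.one Q).carrier),
    ⨅ _ : q.map Prod.snd = p,
      hom (lawsonLim (q.map fun z => z.2 z.1 PUnit.unit))
        (ψ (join (q.map Prod.fst)) PUnit.unit)

namespace WeightClass

variable (J : WeightClass Q) (X : UVCat Q)

/-- The set `JX` of all distributors `X ⇸ 1` in `J`. -/
def Presheaf : Type u :=
  {ψ : URel Q X.carrier (UVCat.one Q).carrier // J.Mem X (UVCat.one Q) ψ}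

/-- The structure of `JX`, as a full subcategory of `Q^|X|`. -/
def presheafStr : URel Q (J.Presheaf X) (J.Presheaf X) :=
  fun p ψ => expStr X (p.map Subtype.val) ψ.1

/-- The Yoneda functor `X → JX`, `x ↦ X(-,x) = x^*`. -/
def yoneda (x : X.carrier) : J.Presheaf X :=
  ⟨X.pointUpper x, J.upperStar_mem (X.isFunctor_point x)⟩

variable {X}

/-- `sup : JX → X` is left adjoint to the Yoneda functor. The `(𝕌,Q)`-category `X` is
`J`-cocomplete when such a `sup` exists. -/
def IsSup (sup : J.Presheaf X → X.carrier) : Prop :=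
  IsAdjunction (J.presheafStr X) X.str sup (J.yoneda X)

/-- `X` is `J`-continuous: the functor `sup : JX → X` has a left adjoint. -/
def IsContinuous (sup : J.Presheaf X → X.carrier) : Prop :=
  ∃ α : X.carrier → J.Presheaf X, IsAdjunction X.str (J.presheafStr X) α sup

/-- `sup^* : X ⇸ JX`. -/
def supUpper (sup : J.Presheaf X → X.carrier) : URel Q X.carrier (J.Presheaf X) :=
  upperStar X.str sup

variable (X) in
/-- `yoneda_* : X ⇸ JX`. -/
def yonedaLower : URel Q X.carrier (J.Presheaf X) :=
  lowerStar (J.presheafStr X) (J.yoneda X)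

/-- `v : X ⇸ Y` is `J`-cocontinuous (where `sup : JY → Y`): `sup^* ∘ v = yoneda_* ∘ v`. -/
def IsCocontinuous {Y : UVCat Q} (sup : J.Presheaf Y → Y.carrier)
    (v : URel Q X.carrier Y.carrier) : Prop :=
  kleisli (J.supUpper sup) v = kleisli (J.yonedaLower Y) v

/-- `v : X ⇸ X` is approximating: `v ∈ J` and `X ◁ v = X`. -/
def IsApproximating (v : URel Q X.carrier X.carrier) : Prop :=
  J.Mem X X v ∧ extension X.str v = X.str

/-- `v : X ⇸ X` is approximating at `x`: `v ∈ J` and `X ◁ v_x = x_*`, where `v_x = x^* ∘ v`. -/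
def IsApproximatingAt (v : URel Q X.carrier X.carrier) (x : X.carrier) : Prop :=
  J.Mem X X v ∧ extension X.str (kleisli (X.pointUpper x) v) = X.pointLower x

/-- `v : X ⇸ X` is the way-below distributor, i.e. the lifting of `yoneda_* : X ⇸ JX` along
`sup^* : X ⇸ JX` in the ordered category of distributors. -/
def IsWayBelow (sup : J.Presheaf X → X.carrier) (v : URel Q X.carrier X.carrier) : Prop :=
  IsDistributor X X v ∧ ∀ γ : URel Q X.carrier X.carrier, IsDistributor X X γ →
    (kleisli (J.supUpper sup) γ ≤ J.yonedaLower X ↔ γ ≤ v)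

end WeightClass

end UVCont

namespace UVCont

/-! ### Ultrafilter extensions of relations, and the order of a category -/

section Relations

variable {Q : Type u} [CompletelyDistribLattice Q]

/-! A map `α : Y → JX` is the same thing as a relation `v : X ⇸ Y` with all fibres in `J` (`mate`,
`fibre`), and functors correspond to distributors in `J`. The Yoneda lemma (`expStr_map`,
`presheafStr_map`) says that the structure of `JX` restricted along `α` is extension along `v`:
`JX(Uα(ν), ψ) = (ψ ◁ v)(ν)`. It rests on `extend_eq_iSup`.

If `α ⊣ sup`, then `α_* = sup^*` reads `X(σ, sup ψ) = (ψ ◁ v)(σ)`. At representable `ψ` this says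
that `v` is approximating; for all `ψ` it makes `v` the way-below distributor. Cocontinuity follows
by comparing `sup ψ` with `sup (ψ ∘ v)`.

Conversely, let `v` in `J` be approximating at points with `sup^* ∘ v ≤ yoneda_*`. Approximation
gives the unit of `fibre ⊣ sup`, and the inequality is exactly the counit. A cocontinuous such `v`
satisfies the inequality, because approximation forces `v ≤ X`. -/

theorem le_lawsonLim {σ : Ultrafilter Q} {u : Q} (h : Set.Ici u ∈ σ) : u ≤ lawsonLim σ := by
  refine le_iInf₂ fun A hA => ?_
  obtain ⟨a, haA, hau⟩ := σ.nonempty_of_mem (Filter.inter_mem hA h)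
  exact le_trans hau (le_sSup haA)

theorem lawsonLim_map_le_extend {X Y : Type u} (r : X → Y → Q) (w : Ultrafilter (X × Y)) :
    lawsonLim (w.map fun z => r z.1 z.2) ≤ extend r (w.map Prod.fst) (w.map Prod.snd) := by
  refine le_iInf₂ fun A hA => le_iInf₂ fun B hB => ?_
  have hAB : A ×ˢ B ∈ w := Filter.inter_mem hA hB
  refine iInf₂_le_of_le ((fun z : X × Y => r z.1 z.2) '' (A ×ˢ B)) (Filter.image_mem_map hAB) ?_
  refine sSup_le ?_
  rintro _ ⟨z, hz, rfl⟩
  exact le_iSup₂_of_le z.1 hz.1 (le_iSup₂_of_le z.2 hz.2 le_rfl)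

/-- An ultrafilter with prescribed marginals `σ` and `ν` that contains `S`, as soon as `S` meets
all rectangles `A × B` with `A ∈ σ` and `B ∈ ν`. -/
theorem exists_ultrafilter_prod {X Y : Type u} {σ : Ultrafilter X} {ν : Ultrafilter Y}
    {S : Set (X × Y)} (h : ∀ A ∈ σ, ∀ B ∈ ν, ∃ p ∈ S, p.1 ∈ A ∧ p.2 ∈ B) :
    ∃ w : Ultrafilter (X × Y), w.map Prod.fst = σ ∧ w.map Prod.snd = ν ∧ S ∈ w := by
  have hne : (((σ : Filter X) ×ˢ (ν : Filter Y)) ⊓ Filter.principal S).NeBot := by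
    rw [Filter.inf_principal_neBot_iff]
    intro U hU
    obtain ⟨A, hA, B, hB, hAB⟩ := Filter.mem_prod_iff.1 hU
    obtain ⟨p, hpS, hpA, hpB⟩ := h A hA B hB
    exact ⟨p, hAB ⟨hpA, hpB⟩, hpS⟩
  have hle := Ultrafilter.of_le (((σ : Filter X) ×ˢ (ν : Filter Y)) ⊓ Filter.principal S)
  refine ⟨Ultrafilter.of _, Ultrafilter.coe_le_coe.1 ?_, Ultrafilter.coe_le_coe.1 ?_,
    hle (Filter.mem_inf_of_right (Filter.mem_principal_self S))⟩
  · exact Filter.tendsto_fst.mono_left (hle.trans inf_le_left)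
  · exact Filter.tendsto_snd.mono_left (hle.trans inf_le_left)

/-- Complete distributivity turns the meet over rectangles of joins into a join over choice
functions, and each choice function yields an ultrafilter with the right marginals. -/
theorem extend_eq_iSup {X Y : Type u} (r : X → Y → Q) (σ : Ultrafilter X) (ν : Ultrafilter Y) :
    extend r σ ν = ⨆ w : Ultrafilter (X × Y), ⨆ _ : w.map Prod.fst = σ,
      ⨆ _ : w.map Prod.snd = ν, lawsonLim (w.map fun z => r z.1 z.2) := by
  refine le_antisymm ?_ (iSup_le fun w => iSup_le fun h₁ => iSup_le fun h₂ => ?_)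
  · have hle : extend r σ ν ≤ ⨅ i : {A // A ∈ σ} × {B // B ∈ ν},
        ⨆ p : {p : X × Y // p.1 ∈ i.1.1 ∧ p.2 ∈ i.2.1}, r p.1.1 p.1.2 := by
      refine le_iInf fun i => ?_
      refine iInf₂_le_of_le i.1.1 i.1.2 (iInf₂_le_of_le i.2.1 i.2.2 ?_)
      exact iSup₂_le fun x hx => iSup₂_le fun y hy =>
        le_iSup (fun p : {p : X × Y // p.1 ∈ i.1.1 ∧ p.2 ∈ i.2.1} => r p.1.1 p.1.2)
          ⟨(x, y), hx, hy⟩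
    refine hle.trans ?_
    rw [iInf_iSup_eq]
    refine iSup_le fun g => ?_
    -- The points chosen by `g` show that the region where `r` is at least `u` meets every
    -- rectangle.
    set u : Q := ⨅ i, r (g i).1.1 (g i).1.2
    obtain ⟨w, h₁, h₂, hw⟩ := exists_ultrafilter_prod (σ := σ) (ν := ν)
      (S := {p | u ≤ r p.1 p.2}) fun A hA B hB =>
        ⟨(g (⟨A, hA⟩, ⟨B, hB⟩)).1, iInf_le _ _, (g (⟨A, hA⟩, ⟨B, hB⟩)).2⟩
    exact le_iSup_of_le w (le_iSup_of_le h₁ (le_iSup_of_le h₂ (le_lawsonLim hw)))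
  · rw [← h₁, ← h₂]
    exact lawsonLim_map_le_extend r w

theorem extend_mono {X Y : Type u} {r s : X → Y → Q} (h : r ≤ s) (σ : Ultrafilter X)
    (ν : Ultrafilter Y) : extend r σ ν ≤ extend s σ ν :=
  iInf₂_mono fun _ _ => iInf₂_mono fun _ _ => iSup₂_mono fun x _ => iSup₂_mono fun y _ => h x y

theorem le_extend_pure {X Y : Type u} (r : X → Y → Q) (x : X) (y : Y) :
    r x y ≤ extend r (pure x) (pure y) :=
  le_iInf₂ fun _ hA => le_iInf₂ fun _ hB => le_iSup₂_of_le x (Ultrafilter.mem_pure.1 hA)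
    (le_iSup₂_of_le y (Ultrafilter.mem_pure.1 hB) le_rfl)

theorem le_extend_map {X Y Z : Type u} {r : X → Y → Q} {f : Z → X} {g : Z → Y} {u : Q}
    (h : ∀ z, u ≤ r (f z) (g z)) (σ : Ultrafilter Z) : u ≤ extend r (σ.map f) (σ.map g) := by
  refine le_iInf₂ fun A hA => le_iInf₂ fun B hB => ?_
  obtain ⟨z, hzA, hzB⟩ := σ.nonempty_of_mem
    (Filter.inter_mem (Ultrafilter.mem_map.1 hA) (Ultrafilter.mem_map.1 hB))
  exact le_iSup₂_of_le (f z) hzA (le_iSup₂_of_le (g z) hzB (h z))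

theorem join_pure {X : Type u} (σ : Ultrafilter X) : join (pure σ) = σ :=
  Ultrafilter.ext fun _ => Iff.rfl

theorem join_map_pure {X : Type u} (σ : Ultrafilter X) : join (σ.map pure) = σ :=
  Ultrafilter.ext fun _ => Iff.rfl

theorem extend_le_lift {X Y : Type u} (α : URel Q X Y) (Υ : Ultrafilter (Ultrafilter X))
    (ν : Ultrafilter Y) : extend α Υ ν ≤ lift α (join Υ) ν :=
  le_iSup₂_of_le Υ rfl le_rfl

theorem le_lift_pure {X Y : Type u} (α : URel Q X Y) (σ : Ultrafilter X) (y : Y) :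
    α σ y ≤ lift α σ (pure y) :=
  le_iSup₂_of_le (pure σ) (join_pure σ) (le_extend_pure α σ y)

theorem lift_mono {X Y : Type u} {α β : URel Q X Y} (h : α ≤ β) (σ : Ultrafilter X)
    (ν : Ultrafilter Y) : lift α σ ν ≤ lift β σ ν :=
  iSup₂_mono fun Υ _ => extend_mono h Υ ν

variable [CommMonoid Q]

theorem lift_mul_le_kleisli {X Y Z : Type u} (β : URel Q Y Z) (α : URel Q X Y)
    (σ : Ultrafilter X) (ν : Ultrafilter Y) (z : Z) :
    lift α σ ν * β ν z ≤ kleisli β α σ z :=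
  le_iSup (fun ν => lift α σ ν * β ν z) ν

variable [IsQuantale Q]

theorem le_hom {x y z : Q} : z ≤ hom x y ↔ z * x ≤ y :=
  Quantale.leftMulResiduation_le_iff_mul_le

theorem kleisli_mono {X Y Z : Type u} {β β' : URel Q Y Z} {α α' : URel Q X Y} (hβ : β ≤ β')
    (hα : α ≤ α') : kleisli β α ≤ kleisli β' α' := fun σ z =>
  iSup_mono fun ν => mul_le_mul' (lift_mono hα σ ν) (hβ ν z)

theorem le_extension_apply_iff {X Y Z : Type u} {γ : URel Q X Z} {α : URel Q X Y}
    {ν : Ultrafilter Y} {z : Z} {u : Q} :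
    u ≤ extension γ α ν z ↔ ∀ σ, u * lift α σ ν ≤ γ σ z := by
  simp only [extension, le_iInf_iff, le_hom]

theorem extension_mul_lift_le {X Y Z : Type u} (γ : URel Q X Z) (α : URel Q X Y)
    (σ : Ultrafilter X) (ν : Ultrafilter Y) (z : Z) :
    extension γ α ν z * lift α σ ν ≤ γ σ z :=
  le_extension_apply_iff.1 le_rfl σ

theorem UVCat.str_mul_le (X : UVCat Q) (σ : Ultrafilter X.carrier) (x y : X.carrier) :
    X.str σ x * X.str (pure x) y ≤ X.str σ y := by
  have h := X.trans (pure σ) (pure x) y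
  rw [join_pure] at h
  exact (mul_le_mul_left (le_extend_pure X.str σ x) _).trans h

theorem UVCat.str_mono (X : UVCat Q) {x y : X.carrier} (h : 1 ≤ X.str (pure x) y)
    (σ : Ultrafilter X.carrier) : X.str σ x ≤ X.str σ y := by
  refine le_trans ?_ (X.str_mul_le σ x y)
  simpa using mul_le_mul_right h (X.str σ x)

theorem UVCat.str_map_le (X : UVCat Q) {f : X.carrier → X.carrier}
    (h : ∀ x, 1 ≤ X.str (pure x) (f x)) (σ : Ultrafilter X.carrier) (x : X.carrier) :
    X.str (σ.map f) x ≤ X.str σ x := by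
  -- `σ.map pure` multiplies back to `σ`, and its extended distance to `σ.map f` is at least `1`.
  have ht := X.trans (σ.map pure) (σ.map f) x
  rw [join_map_pure] at ht
  refine le_trans ?_ ht
  simpa using mul_le_mul_left (le_extend_map h σ) (X.str (σ.map f) x)

theorem UVCat.le_kleisli_str (X : UVCat Q) {Y : Type u} (α : URel Q Y X.carrier) :
    α ≤ kleisli X.str α := fun σ x => by
  refine le_trans ?_ (lift_mul_le_kleisli X.str α σ (pure x) x)
  simpa using mul_le_mul' (le_lift_pure α σ x) (X.refl x)

/-- Evaluating the extension at `(pure x, x)`, reflexivity puts the value above `1`, so it can be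
cancelled. -/
theorem UVCat.le_str_of_approximating (X : UVCat Q) {v : URel Q X.carrier X.carrier}
    (h : ∀ x z, extension X.str v (pure x) z = X.str (pure x) z) : v ≤ X.str := by
  intro σ x
  have h1 := extension_mul_lift_le X.str v σ (pure x) x
  rw [h] at h1
  refine le_trans ?_ h1
  rw [mul_comm]
  simpa using mul_le_mul' (le_lift_pure v σ x) (X.refl x)

end Relations

/-! ### The Yoneda lemma and the mates of maps into `JX` -/

section Presheaves

variable {Q : Type u} [CompletelyDistribLattice Q] [CommMonoid Q] [IsQuantale Q]
  [IsLawsonQuantale Q]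

theorem lift_one {X : UVCat Q} {ψ : URel Q X.carrier (UVCat.one Q).carrier}
    (h : IsDistributor X (UVCat.one Q) ψ) (σ : Ultrafilter X.carrier) :
    lift ψ σ (pure PUnit.unit) = ψ σ PUnit.unit := by
  refine le_antisymm ?_ (le_lift_pure ψ σ _)
  have := lift_mul_le_kleisli (UVCat.one Q).str ψ σ (pure PUnit.unit) PUnit.unit
  rw [h.2] at this
  simpa [UVCat.one] using this

/-- Ultrafilters can be lifted along pullbacks of a projection. -/
theorem exists_ultrafilter_map_snd {A Y C : Type u} (α : Y → C) {q : Ultrafilter (A × C)}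
    {ν : Ultrafilter Y} (h : q.map Prod.snd = ν.map α) :
    ∃ w : Ultrafilter (A × Y), w.map (Prod.map id α) = q ∧ w.map Prod.snd = ν := by
  obtain ⟨w, h₁, h₂, hw⟩ := exists_ultrafilter_prod (σ := q) (ν := ν)
    (S := {p | p.1.2 = α p.2}) fun S hS T hT => by
      have hT' : α '' T ∈ q.map Prod.snd := h ▸ Filter.image_mem_map hT
      obtain ⟨z, hzS, y, hyT, hyz⟩ := q.nonempty_of_mem (Filter.inter_mem hS hT')
      exact ⟨(z, y), hyz.symm, hzS, hyT⟩
  refine ⟨w.map fun p => (p.1.1, p.2), ?_, ?_⟩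
  · rw [← h₁, Ultrafilter.map_map]
    refine Ultrafilter.coe_injective (Filter.map_congr ?_)
    filter_upwards [hw] with p hp
    exact Prod.ext rfl (Eq.symm hp)
  · rw [Ultrafilter.map_map]
    exact h₂

/-- The Yoneda lemma: if `α : Y → Q^|X|` is the mate of `v : X ⇸ Y`, then the structure of `Q^|X|`
restricted along `α` computes the extension along `v`. -/
theorem expStr_map {X : UVCat Q} {Y : Type u} (v : URel Q X.carrier Y)
    (ν : Ultrafilter Y) (ψ : URel Q X.carrier (UVCat.one Q).carrier) :
    expStr X (ν.map fun y σ _ => v σ y) ψ = extension ψ v ν PUnit.unit := by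
  refine le_antisymm ?_ ?_
  · refine le_extension_apply_iff.2 fun σ => ?_
    rw [mul_comm, ← le_hom, lift]
    refine iSup₂_le ?_
    rintro Υ rfl
    rw [extend_eq_iSup]
    refine iSup_le fun w => iSup_le fun h₁ => iSup_le fun h₂ => ?_
    rw [le_hom, mul_comm, ← le_hom]
    -- Pushing `w` forward along `id × α` gives one of the ultrafilters in the meet defining
    -- `expStr`.
    refine iInf₂_le_of_le (w.map (Prod.map id fun y σ _ => v σ y)) ?_ ?_
    · rw [← h₂, Ultrafilter.map_map, Ultrafilter.map_map]
      rfl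
    · rw [Ultrafilter.map_map, Ultrafilter.map_map, ← h₁]
      exact le_rfl
  · refine le_iInf₂ fun q hq => ?_
    -- Conversely, every ultrafilter in that meet is such a pushforward.
    obtain ⟨w, rfl, rfl⟩ := exists_ultrafilter_map_snd _ hq
    rw [le_hom]
    refine le_trans (mul_le_mul_right ?_ _) (extension_mul_lift_le ψ v _ (w.map Prod.snd) _)
    rw [Ultrafilter.map_map, Ultrafilter.map_map]
    exact (lawsonLim_map_le_extend v w).trans (extend_le_lift v _ _)

namespace WeightClass

variable {J : WeightClass Q} {X : UVCat Q}

/-- The underlying relation of an element of `JX`. -/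
def Presheaf.rel (ψ : J.Presheaf X) : URel Q X.carrier (UVCat.one Q).carrier :=
  Subtype.val ψ

theorem Presheaf.mem (ψ : J.Presheaf X) : J.Mem X (UVCat.one Q) ψ.rel :=
  Subtype.property ψ

/-- The relation `X ⇸ Y` corresponding to a map `Y → JX`. -/
def mate {Y : Type u} (α : Y → J.Presheaf X) : URel Q X.carrier Y :=
  fun σ y => (α y).rel σ PUnit.unit

theorem mate_yoneda : mate (J.yoneda X) = X.str :=
  rfl

theorem presheafStr_map {Y : Type u} (α : Y → J.Presheaf X) (ν : Ultrafilter Y)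
    (ψ : J.Presheaf X) :
    J.presheafStr X (ν.map α) ψ = extension ψ.rel (mate α) ν PUnit.unit :=
  expStr_map (mate α) ν ψ.rel

theorem one_le_presheafStr_pure_iff {φ ψ : J.Presheaf X} :
    1 ≤ J.presheafStr X (pure φ) ψ ↔ φ.rel ≤ ψ.rel := by
  have h : J.presheafStr X (pure φ) ψ = extension ψ.rel φ.rel (pure PUnit.unit) PUnit.unit :=
    presheafStr_map (fun _ : (UVCat.one Q).carrier => φ) (pure PUnit.unit) ψ
  rw [h]
  refine le_extension_apply_iff.trans ?_
  have hl : ∀ σ, 1 * lift φ.rel σ (pure PUnit.unit) = φ.rel σ PUnit.unit := fun σ =>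
    (one_mul _).trans (lift_one (J.isDistributor φ.mem) σ)
  exact ⟨fun H σ _ => (hl σ).symm.trans_le (H σ), fun H σ => (hl σ).trans_le (H σ _)⟩

theorem yonedaLower_apply (σ : Ultrafilter X.carrier) (ψ : J.Presheaf X) :
    J.yonedaLower X σ ψ = ψ.rel σ PUnit.unit := by
  refine (presheafStr_map (J.yoneda X) σ ψ).trans ?_
  rw [mate_yoneda]
  refine le_antisymm ?_ ?_
  · refine le_trans ?_ (extension_mul_lift_le ψ.rel X.str σ σ PUnit.unit)
    have h1 : (1 : Q) ≤ lift X.str σ σ := by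
      have := (le_extend_map (u := (1 : Q)) X.refl σ).trans
        (extend_le_lift X.str (σ.map pure) (σ.map id))
      rwa [join_map_pure, Ultrafilter.map_id] at this
    simpa using mul_le_mul_right h1 (extension ψ.rel X.str σ PUnit.unit)
  · refine le_extension_apply_iff.2 fun τ => ?_
    rw [mul_comm]
    refine (lift_mul_le_kleisli ψ.rel X.str τ σ PUnit.unit).trans ?_
    rw [(J.isDistributor ψ.mem).1]

theorem presheafStr_mono {φ ψ : J.Presheaf X} (h : φ.rel ≤ ψ.rel)
    (p : Ultrafilter (J.Presheaf X)) : J.presheafStr X p φ ≤ J.presheafStr X p ψ := by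
  refine iInf₂_mono fun q _ => ?_
  rw [le_hom]
  exact (le_hom.1 le_rfl).trans (h _ _)

/-- A map `Y → JX` is a functor if and only if its mate is a distributor. -/
theorem isFunctor_iff_kleisli_mate_le {Y : UVCat Q} {α : Y.carrier → J.Presheaf X} :
    IsFunctor Y.str (J.presheafStr X) α ↔ kleisli Y.str (mate α) ≤ mate α := by
  constructor
  · intro h σ y
    refine iSup_le fun ν => ?_
    have := h ν y
    rw [presheafStr_map] at this
    exact (mul_comm _ _).trans_le (le_extension_apply_iff.1 this σ)
  · intro h ν y
    rw [presheafStr_map]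
    exact le_extension_apply_iff.2 fun σ => (mul_comm _ _).trans_le ((lift_mul_le_kleisli _ _ σ ν y).trans (h σ y))

theorem isDistributor_mate {Y : UVCat Q} {α : Y.carrier → J.Presheaf X}
    (h : IsFunctor Y.str (J.presheafStr X) α) : IsDistributor X Y (mate α) := by
  refine ⟨?_, le_antisymm (isFunctor_iff_kleisli_mate_le.1 h) (Y.le_kleisli_str _)⟩
  funext σ y
  exact congrFun (congrFun (J.isDistributor (α y).mem).1 σ) PUnit.unit

theorem mem_mate {Y : UVCat Q} {α : Y.carrier → J.Presheaf X}
    (h : IsFunctor Y.str (J.presheafStr X) α) : J.Mem X Y (mate α) := by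
  have hd := isDistributor_mate h
  refine J.of_points hd fun y => ?_
  -- The left side is the fibre over `y` of `Y ∘ mate α`, and `Y ∘ mate α = mate α`.
  have : kleisli (Y.pointUpper y) (mate α) = (α y).rel :=
    funext fun σ => funext fun _ => congrFun (congrFun hd.2 σ) y
  rw [this]
  exact (α y).mem

/-- The map `Y → JX`, `y ↦ y^* ∘ v`, for `v : X ⇸ Y` in `J`. -/
def fibre {Y : UVCat Q} {v : URel Q X.carrier Y.carrier} (hv : J.Mem X Y v) (y : Y.carrier) :
    J.Presheaf X :=
  ⟨kleisli (Y.pointUpper y) v, J.comp hv (J.upperStar_mem (Y.isFunctor_point y))⟩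

theorem mate_fibre {Y : UVCat Q} {v : URel Q X.carrier Y.carrier} (hv : J.Mem X Y v) :
    mate (fibre hv) = v :=
  (J.isDistributor hv).2

theorem isFunctor_fibre {Y : UVCat Q} {v : URel Q X.carrier Y.carrier} (hv : J.Mem X Y v) :
    IsFunctor Y.str (J.presheafStr X) (fibre hv) := by
  rw [isFunctor_iff_kleisli_mate_le, mate_fibre, (J.isDistributor hv).2]

/-! ### Left adjoints of `sup` and approximating distributors -/

section Sup

variable {sup : J.Presheaf X → X.carrier}

namespace IsSup

theorem rel_le (hsup : J.IsSup sup) (ψ : J.Presheaf X) :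
    ψ.rel ≤ (J.yoneda X (sup ψ)).rel :=
  one_le_presheafStr_pure_iff.1 (hsup.unit ψ)

theorem le_of_rel_le (hsup : J.IsSup sup) {ψ : J.Presheaf X} {z : X.carrier}
    (h : ψ.rel ≤ (J.yoneda X z).rel) : 1 ≤ X.str (pure (sup ψ)) z := by
  have h1 := (one_le_presheafStr_pure_iff.2 h).trans (hsup.left (pure ψ) (J.yoneda X z))
  exact h1.trans (X.str_mono (hsup.counit z) _)

theorem str_sup_yoneda (hsup : J.IsSup sup) (σ : Ultrafilter X.carrier) (x : X.carrier) :
    X.str σ (sup (J.yoneda X x)) = X.str σ x :=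
  le_antisymm (X.str_mono (hsup.counit x) σ)
    (hsup.rel_le (J.yoneda X x) σ PUnit.unit)

theorem yonedaLower_le_supUpper (hsup : J.IsSup sup) : J.yonedaLower X ≤ J.supUpper sup := by
  intro σ ψ
  rw [yonedaLower_apply]
  exact hsup.rel_le ψ σ PUnit.unit

end IsSup

/-- The identity `α_* = sup^*` for `α` left adjoint to `sup`. -/
theorem str_sup_eq_extension {α : X.carrier → J.Presheaf X}
    (hα : IsAdjunction X.str (J.presheafStr X) α sup) (σ : Ultrafilter X.carrier)
    (ψ : J.Presheaf X) : X.str σ (sup ψ) = extension ψ.rel (mate α) σ PUnit.unit := by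
  rw [← presheafStr_map]
  refine le_antisymm ?_ ?_
  · exact (hα.left σ (sup ψ)).trans
      (presheafStr_mono (one_le_presheafStr_pure_iff.1 (hα.counit ψ)) _)
  · have h := hα.right (σ.map α) ψ
    rw [Ultrafilter.map_map] at h
    exact h.trans (X.str_map_le hα.unit σ _)

theorem isApproximating_mate (hsup : J.IsSup sup) {α : X.carrier → J.Presheaf X}
    (hα : IsAdjunction X.str (J.presheafStr X) α sup) : J.IsApproximating (mate α) := by
  refine ⟨mem_mate hα.left, ?_⟩
  funext σ x
  exact (str_sup_eq_extension hα σ (J.yoneda X x)).symm.trans (hsup.str_sup_yoneda σ x)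

theorem isWayBelow_mate {α : X.carrier → J.Presheaf X}
    (hα : IsAdjunction X.str (J.presheafStr X) α sup) : J.IsWayBelow sup (mate α) := by
  refine ⟨isDistributor_mate hα.left, fun γ _ => ⟨fun h σ x => ?_, fun h σ ψ => ?_⟩⟩
  -- Testing at `α x` suffices, since the unit gives `x ≤ sup (α x)`.
  · have h1 := h σ (α x)
    rw [yonedaLower_apply] at h1
    refine le_trans ?_ h1
    refine le_trans ?_ (lift_mul_le_kleisli _ γ σ (pure x) _)
    exact (mul_one _).symm.trans_le (mul_le_mul' (le_lift_pure γ σ x) (hα.unit x))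
  · rw [yonedaLower_apply]
    refine iSup_le fun ν => ?_
    refine (mul_le_mul' (lift_mono h σ ν) (str_sup_eq_extension hα ν ψ).le).trans ?_
    rw [mul_comm]
    exact extension_mul_lift_le _ _ _ _ _

theorem isCocontinuous_mate (hsup : J.IsSup sup) {α : X.carrier → J.Presheaf X}
    (hα : IsAdjunction X.str (J.presheafStr X) α sup) : J.IsCocontinuous sup (mate α) := by
  refine le_antisymm (fun σ ψ => ?_) (kleisli_mono hsup.yonedaLower_le_supUpper le_rfl)
  have hmem := mem_mate hα.left
  have hy : J.yonedaLower X = fun σ (ψ : J.Presheaf X) => ψ.rel σ PUnit.unit :=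
    funext fun σ => funext fun ψ => yonedaLower_apply σ ψ
  let χ : J.Presheaf X := ⟨kleisli ψ.rel (mate α), J.comp hmem ψ.mem⟩
  -- Transpose `ψ ∘ v ≤ X(-, sup χ)` across `(-) ∘ v ⊣ (-) ◁ v` and use `X ◁ v = X`; hence `sup ψ ≤
  -- sup χ`.
  have hψ : ψ.rel ≤ (J.yoneda X (sup χ)).rel := by
    have h1 : kleisli ψ.rel (mate α) ≤ (J.yoneda X (sup χ)).rel := hsup.rel_le χ
    rw [kleisli_le_iff] at h1
    intro τ p
    refine (h1 τ p).trans ?_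
    exact (congrFun (congrFun (isApproximating_mate hsup hα).2 τ) (sup χ)).le
  have hle := hsup.le_of_rel_le hψ
  calc kleisli (J.supUpper sup) (mate α) σ ψ
      = mate α σ (sup ψ) := congrFun (congrFun (isDistributor_mate hα.left).2 σ) (sup ψ)
    _ ≤ lift (mate α) σ (pure (sup ψ)) * X.str (pure (sup ψ)) (sup χ) := by
      simpa using mul_le_mul' (le_lift_pure (mate α) σ (sup ψ)) hle
    _ ≤ kleisli X.str (mate α) σ (sup χ) := lift_mul_le_kleisli _ _ _ _ _
    _ = mate α σ (sup χ) := congrFun (congrFun (isDistributor_mate hα.left).2 σ) (sup χ)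
    _ ≤ χ.rel σ PUnit.unit := one_le_presheafStr_pure_iff.1 (hα.counit χ) σ PUnit.unit
    _ = kleisli (J.yonedaLower X) (mate α) σ ψ := by rw [hy]; rfl

/-- By the Yoneda lemma both sides are the structure of `JX` from the principal ultrafilter at `x^*
∘ v` to `z^*`. -/
theorem extension_kleisli_pointUpper {v : URel Q X.carrier X.carrier} (hv : J.Mem X X v)
    (x z : X.carrier) (ν : Ultrafilter (UVCat.one Q).carrier) :
    extension X.str (kleisli (X.pointUpper x) v) ν z = extension X.str v (pure x) z := by
  have hν : ν.map (fun _ => x) = pure x := Ultrafilter.coe_injective Filter.map_const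
  have h1 := presheafStr_map (fun _ : (UVCat.one Q).carrier => fibre hv x) ν (J.yoneda X z)
  have h2 := presheafStr_map (fibre hv) (pure x) (J.yoneda X z)
  rw [mate_fibre] at h2
  have h3 : ν.map (fun _ => fibre hv x) = (pure x : Ultrafilter X.carrier).map (fibre hv) := by
    rw [← hν, Ultrafilter.map_map]
    rfl
  rw [h3] at h1
  exact h1.symm.trans h2

theorem isApproximatingAt_iff {v : URel Q X.carrier X.carrier} (hv : J.Mem X X v)
    (x : X.carrier) :
    J.IsApproximatingAt v x ↔ ∀ z, extension X.str v (pure x) z = X.str (pure x) z := by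
  have hx : ∀ (ν : Ultrafilter (UVCat.one Q).carrier) z,
      X.pointLower x ν z = X.str (pure x) z := fun ν z =>
    congrArg (X.str · z) (Ultrafilter.coe_injective Filter.map_const)
  constructor
  · intro h z
    have := congrFun (congrFun h.2 (pure PUnit.unit)) z
    rwa [extension_kleisli_pointUpper hv, hx] at this
  · intro h
    refine ⟨hv, funext fun ν => funext fun z => ?_⟩
    rw [extension_kleisli_pointUpper hv, hx, h]

/-- A distributor in `J` that is approximating at all points and satisfies `sup^* ∘ v ≤ yoneda_*`
is the mate of a left adjoint of `sup`. -/
theorem isContinuous_of_approximating (hsup : J.IsSup sup) {v : URel Q X.carrier X.carrier}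
    (hv : J.Mem X X v) (h : ∀ x z, extension X.str v (pure x) z = X.str (pure x) z)
    (hle : kleisli (J.supUpper sup) v ≤ J.yonedaLower X) : J.IsContinuous sup := by
  refine ⟨fibre hv, isFunctor_fibre hv, hsup.left, fun x => ?_, fun ψ => ?_⟩
  · have h1 := presheafStr_map (fibre hv) (pure x) (J.yoneda X (sup (fibre hv x)))
    rw [mate_fibre] at h1
    have h2 : extension X.str v (pure x) (sup (fibre hv x)) = _ := h x _
    rw [← h2]
    exact (hsup.unit (fibre hv x)).trans h1.le
  · rw [one_le_presheafStr_pure_iff]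
    intro σ p
    have h1 := hle σ ψ
    rw [yonedaLower_apply] at h1
    refine le_trans ?_ h1
    -- By definition, `sup^* ∘ v` at `ψ` is the fibre of `X ∘ v` over `sup ψ`.
    exact le_rfl

theorem isContinuous_of_isCocontinuous (hsup : J.IsSup sup) {v : URel Q X.carrier X.carrier}
    (hv : J.Mem X X v) (h : ∀ x z, extension X.str v (pure x) z = X.str (pure x) z)
    (hco : J.IsCocontinuous sup v) : J.IsContinuous sup := by
  refine isContinuous_of_approximating hsup hv h (hco.trans_le fun σ ψ => ?_)
  rw [yonedaLower_apply]
  -- From `v ≤ X` one gets `yoneda_* ∘ v ≤ yoneda_* ∘ X = yoneda_*`.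
  refine (kleisli_mono le_rfl (X.le_str_of_approximating h) σ ψ).trans ?_
  have hy : J.yonedaLower X = fun σ (ψ : J.Presheaf X) => ψ.rel σ PUnit.unit :=
    funext fun σ => funext fun ψ => yonedaLower_apply σ ψ
  rw [hy]
  exact (congrFun (congrFun (J.isDistributor ψ.mem).1 σ) PUnit.unit).le

end Sup

end WeightClass

end Presheaves

end UVCont

/-! ### The equivalence -/

theorem mainTheorem4 {Q : Type u} [CompletelyDistribLattice Q] [CommMonoid Q] [IsQuantale Q]
    [UVCont.IsLawsonQuantale Q] (J : UVCont.WeightClass Q) (X : UVCont.UVCat Q)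
    (sup : J.Presheaf X → X.carrier) (hsup : J.IsSup sup) :
    List.TFAE [
      J.IsContinuous sup,
      ∃ v : UVCont.URel Q X.carrier X.carrier, J.IsWayBelow sup v ∧ J.IsApproximating v,
      ∃ v : UVCont.URel Q X.carrier X.carrier, UVCont.IsDistributor X X v ∧
        J.IsCocontinuous sup v ∧ J.IsApproximating v,
      ∃ v : UVCont.URel Q X.carrier X.carrier, UVCont.IsDistributor X X v ∧
        J.IsCocontinuous sup v ∧ ∀ x : X.carrier, J.IsApproximatingAt v x] := by
  open UVCont UVCont.WeightClass in
  tfae_have 1 → 2 := fun ⟨α, hα⟩ => ⟨mate α, isWayBelow_mate hα, isApproximating_mate hsup hα⟩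
  tfae_have 2 → 1 := fun ⟨v, hw, hmem, hv⟩ =>
    isContinuous_of_approximating hsup hmem (fun x z => congrFun (congrFun hv _) z)
      ((hw.2 v hw.1).2 le_rfl)
  tfae_have 1 → 3 := fun ⟨α, hα⟩ =>
    ⟨mate α, isDistributor_mate hα.left, isCocontinuous_mate hsup hα,
      isApproximating_mate hsup hα⟩
  tfae_have 3 → 4 := fun ⟨v, hd, hc, hmem, hv⟩ => ⟨v, hd, hc, fun x =>
    (isApproximatingAt_iff hmem x).2 fun z => congrFun (congrFun hv _) z⟩
  tfae_have 4 → 1 := by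
    rintro ⟨v, hd, hc, hv⟩
    -- Going through points also covers empty `X`, where the pointwise condition is vacuous.
    have hmem : J.Mem X X v := J.of_points hd fun x =>
      J.comp (hv x).1 (J.upperStar_mem (X.isFunctor_point x))
    exact isContinuous_of_isCocontinuous hsup hmem
      (fun x => (isApproximatingAt_iff hmem x).1 (hv x)) hc
  tfae_finish
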